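/- Let $v_1,\dots,v_m\in\mathbb Z^d$, let $w_1,\dots,w_m$ be positive integers, and let $C'\subset\mathbb R^{d+1}$ be the cone generated by the vectors $(v_i,w_i)$, $i=1,\dots,m$. Suppose that $C'$ has an interior point and fix $x\in\operatorname{int}(C')$. For a facet $F$ of $C'$ let $\sigma_F$ be the corresponding support form, that is, the unique linear form with coprime integral coefficients such that $\sigma_F\ge 0$ on $C'$ and $F=\{y\in C':\sigma_F(y)=0\}$. The bottom facets of $C'$ are the facets $F$ for which the last coordinate of $\sigma_F$ is positive; the bottom of $C'$ is the set of all bottom facets and all their faces. Assume that all bottom facets are simplicial (generated by linearly independent vectors). With $v=(0,\dots,0,-1)\in\mathbb R^{d+1}$ put $\rho_F=-\sigma_F/\sigma_F(v)$ for each bottom facet $F$. Define $F<\tilde F$ if $\rho_F(x)<\rho_{\tilde F}(x)$, or if $\rho_F(x)=\rho_{\tilde F}(x)$ and $\rho_F$ precedes $\rho_{\tilde F}$ in the lexicographic order on $(\mathbb R^{d+1})^*$ (the order of coefficient vectors). Then $<$ is a strict total order on the finite set of bottom facets, and if $F_1<\dots<F_k$ are the bottom facets in this order, then $F_1,\dots,F_k$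 is a shelling of the bottom of $C'$: the bottom is a complex of simplicial cones whose maximal cones are exactly $F_1,\dots,F_k$, all of dimension $d$, and for every $i$ the set $F_i\cap(F_1\cup\dots\cup F_{i-1})$ is a union of facets of $F_i$ (the empty union for $i=1$). -/

import Mathlib

noncomputable section

namespace LiftedCone

open Module

/-- The dimension of a cone: the dimension of the linear subspace that it spans. -/
def coneDim {n : ℕ} (C : PointedCone ℝ (Fin n → ℝ)) : ℕ :=
  finrank ℝ (Submodule.span ℝ (C : Set (Fin n → ℝ)))

/-- A facet of `C` is a face of codimension one. -/
def IsFacet {n : ℕ} (F C : PointedCone ℝ (Fin n → ℝ)) : Prop :=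
  F.IsFaceOf C ∧ coneDim F + 1 = coneDim C

/-- A linear form is primitive if its coefficients are integers with greatest common divisor 1. -/
def IsPrimitive {n : ℕ} (σ : Dual ℝ (Fin n → ℝ)) : Prop :=
  ∃ a : Fin n → ℤ, (∀ i, σ (Pi.single i 1) = (a i : ℝ)) ∧ Finset.univ.gcd a = 1

/-- `σ` is a support form of `C` corresponding to the face `F`: it is primitive, nonnegative on
`C`, and `F` consists of the points of `C` at which it vanishes. -/
structure IsSupportForm {n : ℕ} (C F : PointedCone ℝ (Fin n → ℝ))
    (σ : Dual ℝ (Fin n → ℝ)) : Prop where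
  primitive : IsPrimitive σ
  nonneg : ∀ y ∈ C, 0 ≤ σ y
  mem_iff : ∀ y ∈ C, y ∈ F ↔ σ y = 0

open Classical in
/-- The support form `σ_F` of `C` corresponding to `F`. For a facet `F` of a full-dimensional
rational cone `C` it exists and is unique; where there is none, the value is `0`. -/
def supportForm {n : ℕ} (C F : PointedCone ℝ (Fin n → ℝ)) : Dual ℝ (Fin n → ℝ) :=
  if h : ∃ σ, IsSupportForm C F σ then h.choose else 0

/-- The cone `C'` in `ℝ^(d+1)` generated by the lifted vectors `(v_i, w_i)`. -/
def liftedCone {d m : ℕ} (v : Fin m → Fin d → ℤ) (w : Fin m → ℤ) :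
    PointedCone ℝ (Fin (d + 1) → ℝ) :=
  PointedCone.hull ℝ (Set.range fun i : Fin m =>
    Fin.snoc (α := fun _ => ℝ) (fun j => (v i j : ℝ)) (w i : ℝ))

/-- The vector `(0, …, 0, -1)`. -/
def down (d : ℕ) : Fin (d + 1) → ℝ := Pi.single (Fin.last d) (-1)

/-- The bottom facets: those whose support form has positive last coordinate. -/
def bottomFacets {d : ℕ} (C : PointedCone ℝ (Fin (d + 1) → ℝ)) :
    Set (PointedCone ℝ (Fin (d + 1) → ℝ)) :=
  {F | IsFacet F C ∧ 0 < supportForm C F (Pi.single (Fin.last d) 1)}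

/-- The bottom: the bottom facets and all their faces. -/
def bottom {d : ℕ} (C : PointedCone ℝ (Fin (d + 1) → ℝ)) :
    Set (PointedCone ℝ (Fin (d + 1) → ℝ)) :=
  {G | ∃ F ∈ bottomFacets C, G.IsFaceOf F}

/-- The normalized form `ρ_F = -σ_F / σ_F(0, …, 0, -1)`. -/
def normForm {d : ℕ} (C F : PointedCone ℝ (Fin (d + 1) → ℝ)) : Dual ℝ (Fin (d + 1) → ℝ) :=
  (-(supportForm C F (down d))⁻¹) • supportForm C F

/-- The coefficient vector of a linear form, in the lexicographically ordered space. -/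
def lexCoeff {n : ℕ} (ρ : Dual ℝ (Fin n → ℝ)) : Lex (Fin n → ℝ) :=
  toLex fun i => ρ (Pi.single i 1)

/-- `F` precedes `G`: compare `ρ_F(x)` and `ρ_G(x)`, and break ties by the lexicographic order
of `ρ_F` and `ρ_G`. -/
def Precedes {d : ℕ} (C : PointedCone ℝ (Fin (d + 1) → ℝ)) (x : Fin (d + 1) → ℝ)
    (F G : PointedCone ℝ (Fin (d + 1) → ℝ)) : Prop :=
  normForm C F x < normForm C G x ∨
    (normForm C F x = normForm C G x ∧ lexCoeff (normForm C F) < lexCoeff (normForm C G))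

/-- A (finite) complex of simplicial cones. -/
structure IsSimplicialComplex {n : ℕ} (K : Set (PointedCone ℝ (Fin n → ℝ))) : Prop where
  finite : K.Finite
  simplicial : ∀ D ∈ K, D.IsSimplicial
  face_mem : ∀ D ∈ K, ∀ G : PointedCone ℝ (Fin n → ℝ), G.IsFaceOf D → G ∈ K
  inter_face : ∀ D ∈ K, ∀ D' ∈ K, (D ⊓ D').IsFaceOf D ∧ (D ⊓ D').IsFaceOf D'

/-- `D 0, …, D (k-1)` is a shelling of `K`: `K` is a complex of simplicial cones whose maximal
cones all have dimension `e`, the `D i` are these maximal cones, each listed once, and each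
intersection `D i ∩ (D 0 ∪ ⋯ ∪ D (i-1))` is a union of facets of `D i` (the empty union
for `i = 0`). -/
structure IsShelling {n : ℕ} (K : Set (PointedCone ℝ (Fin n → ℝ))) (e : ℕ) {k : ℕ}
    (D : Fin k → PointedCone ℝ (Fin n → ℝ)) : Prop where
  isComplex : IsSimplicialComplex K
  pure : ∀ M, Maximal (· ∈ K) M → coneDim M = e
  injective : Function.Injective D
  range_eq : Set.range D = {M | Maximal (· ∈ K) M}
  inter_eq : ∀ i, ∃ S : Set (PointedCone ℝ (Fin n → ℝ)),
    (∀ G ∈ S, IsFacet G (D i)) ∧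
      (D i : Set (Fin n → ℝ)) ∩ (⋃ j, ⋃ (_ : j < i), (D j : Set (Fin n → ℝ))) =
        ⋃ G ∈ S, (G : Set (Fin n → ℝ))

end LiftedCone

end

/-!
Let `ρ_F` be the normalized form of a bottom facet `F`, put `e = (0, …, 0, 1)`, and let `Φ` map a
linear form to its value at `x` followed by its coefficients, lexicographically ordered. Since `x`
is an interior point, `Φ` is a linear map into an ordered vector space that is positive on the
nonzero forms nonnegative on the cone, and the facets are ordered by `Φ ρ_F`; so no perturbation of
`x` is needed to break ties.

The generators `b_i` of `F` together with `e` form a basis, whose dual basis consists of `ρ_F`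
(dual to `e`) and of forms `τ_i`. If `Φ ρ_{F'} < Φ ρ_F`, then expanding
`ρ_{F'} = ρ_F + ∑ i, ρ_{F'}(b_i) τ_i` gives an `i` with `ρ_{F'}(b_i) > 0` and `Φ τ_i < 0`. The
first inequality puts `F ∩ F'` into the facet `G` of `F` opposite to `b_i`. The facet adjacent to
`F` through `G` is cut out by a form `τ_i + r ρ_F`, whose positivity under `Φ` forces `r > 0`. Hence
it is a bottom facet with normalized form `ρ_F + r⁻¹ τ_i`, which precedes `F`.
-/

namespace LiftedCone

open Module PointedCone

section Faces

variable {R E : Type*} [Ring R] [PartialOrder R] [IsOrderedRing R] [AddCommGroup E] [Module R E]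

theorem hull_inter_eq_of_isFaceOf_hull {s : Set E} {G : PointedCone R E}
    (hG : G.IsFaceOf (hull R s)) : hull R (s ∩ G) = G := by
  refine le_antisymm (Submodule.span_le.2 Set.inter_subset_right) fun y hyG => ?_
  have hy : y ∈ hull R s := hG.le hyG
  induction hy using Submodule.span_induction with
  | mem z hz => exact subset_hull ⟨hz, hyG⟩
  | zero => exact zero_mem _
  | add a b ha hb iha ihb =>
    obtain ⟨haG, hbG⟩ := (hG.add_mem_iff_mem ha hb).1 hyG
    exact add_mem (iha haG) (ihb hbG)
  | smul c z hz ih =>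
    rcases eq_or_lt_of_le c.2 with hc | hc
    · rw [show c = 0 from Subtype.ext hc.symm, zero_smul]
      exact zero_mem _
    · refine Submodule.smul_mem _ c (ih (hG.mem_of_smul_add_mem hz (zero_mem _) hc ?_))
      rwa [add_zero]

theorem finite_setOf_isFaceOf_hull {s : Set E} (hs : s.Finite) :
    {G : PointedCone R E | G.IsFaceOf (hull R s)}.Finite := by
  refine (hs.finite_subsets.image (hull R)).subset fun G hG => ?_
  exact ⟨s ∩ G, Set.inter_subset_left, hull_inter_eq_of_isFaceOf_hull hG⟩

theorem isSimplicial_of_isFaceOf {G D : PointedCone R E} (hG : G.IsFaceOf D)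
    (hD : D.IsSimplicial) : G.IsSimplicial := by
  obtain ⟨s, hs, hli, rfl⟩ := hD
  exact ⟨_, hs.inter_of_left _, hli.mono Set.inter_subset_left, hull_inter_eq_of_isFaceOf_hull hG⟩

theorem span_hull (s : Set E) : Submodule.span R (hull R s : Set E) = Submodule.span R s :=
  Submodule.span_span_of_tower _ R s

theorem nonneg_of_mem_hull {s : Set E} {σ : Dual R E} (h : ∀ y ∈ s, 0 ≤ σ y) :
    ∀ y ∈ hull R s, 0 ≤ σ y := by
  intro y hy
  induction hy using Submodule.span_induction with
  | mem y hy => exact h y hy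
  | zero => rw [map_zero]
  | add a b _ _ iha ihb => rw [map_add]; exact add_nonneg iha ihb
  | smul c y _ ih =>
    rw [show σ (c • y) = (c : R) * σ y from map_smul σ (c : R) y]
    exact mul_nonneg c.2 ih

/-- The points of the cone `C` at which the linear form `σ` vanishes; it is a face of `C` when `σ`
is nonnegative on `C`. -/
def zeroFace (C : PointedCone R E) (σ : Dual R E) : PointedCone R E :=
  C ⊓ ofSubmodule (LinearMap.ker σ)

theorem mem_zeroFace {C : PointedCone R E} {σ : Dual R E} {y : E} :
    y ∈ zeroFace C σ ↔ y ∈ C ∧ σ y = 0 := Iff.rfl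

theorem span_zeroFace_le_ker (C : PointedCone R E) (σ : Dual R E) :
    Submodule.span R (zeroFace C σ : Set E) ≤ LinearMap.ker σ :=
  Submodule.span_le.2 fun _ hy => (mem_zeroFace.1 hy).2

end Faces

section ZeroFace

variable {K E : Type*} [Field K] [LinearOrder K] [AddCommGroup E] [Module K E]

theorem exists_pos_of_span_eq_top {t : Set E} (ht : Submodule.span K t = ⊤) {σ : Dual K E}
    (hσ : σ ≠ 0) (h : ∀ y ∈ t, 0 ≤ σ y) : ∃ u ∈ t, 0 < σ u := by
  contrapose! hσ
  rw [← LinearMap.ker_eq_top, ← top_le_iff, ← ht, Submodule.span_le]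
  exact fun y hy => le_antisymm (hσ y hy) (h y hy)

variable [IsStrictOrderedRing K]

theorem zeroFace_smul (C : PointedCone K E) (σ : Dual K E) {r : K} (hr : r ≠ 0) :
    zeroFace C (r • σ) = zeroFace C σ := by
  ext y
  simp [mem_zeroFace, hr]

theorem zeroFace_isFaceOf {C : PointedCone K E} {σ : Dual K E} (h : ∀ y ∈ C, 0 ≤ σ y) :
    (zeroFace C σ).IsFaceOf C := by
  refine IsFaceOf.of_mem_of_add_mem_left inf_le_left fun {y z} hy hz hyz => ?_
  have hsum : σ y + σ z = 0 := by simpa using (mem_zeroFace.1 hyz).2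
  exact ⟨hy, ((add_eq_zero_iff_of_nonneg (h y hy) (h z hz)).1 hsum).1⟩

theorem zeroFace_hull {s : Set E} {σ : Dual K E} (h : ∀ y ∈ s, 0 ≤ σ y) :
    zeroFace (hull K s) σ = hull K {y ∈ s | σ y = 0} := by
  rw [← hull_inter_eq_of_isFaceOf_hull (zeroFace_isFaceOf (nonneg_of_mem_hull h))]
  congr 1
  ext y
  exact and_congr_right fun hy => and_iff_right (subset_hull hy)

/-- Among the admissible `r` one takes the maximum of `-τ u / ρ u` over the `u` with `0 < ρ u`. -/
theorem exists_tight_add_smul {t : Set E} (ht : t.Finite) {ρ τ : Dual K E}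
    (hρ : ∀ u ∈ t, 0 ≤ ρ u) (hpos : ∃ u ∈ t, 0 < ρ u) (hτ : ∀ u ∈ t, ρ u = 0 → 0 ≤ τ u) :
    ∃ r : K, (∀ u ∈ t, 0 ≤ (τ + r • ρ) u) ∧ ∃ u ∈ t, 0 < ρ u ∧ (τ + r • ρ) u = 0 := by
  obtain ⟨u, ⟨hut, hu⟩, hmax⟩ :=
    (ht.sep fun u => 0 < ρ u).exists_maximalFor (fun u => -τ u / ρ u) _ hpos
  refine ⟨-τ u / ρ u, fun z hz => ?_, u, hut, hu, by simp [hu.ne']⟩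
  rw [LinearMap.add_apply, LinearMap.smul_apply, smul_eq_mul, ← neg_le_iff_add_nonneg']
  rcases (hρ z hz).eq_or_lt with h0 | hpz
  · simpa [← h0] using hτ z hz h0.symm
  · rw [← div_le_iff₀ hpz]
    exact not_lt.1 fun hlt => hlt.not_ge (hmax ⟨hz, hpz⟩ hlt.le)

theorem exists_zeroFace_hull_eq_hull_sdiff_singleton {s : Set E}
    (hli : LinearIndepOn K id s) {g : E} (hg : g ∈ s) :
    ∃ τ : Dual K E, (∀ y ∈ s, 0 ≤ τ y) ∧
      zeroFace (hull K s) τ = hull K (s \ {g}) := by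
  obtain ⟨f, hfg, hf⟩ :=
    Submodule.exists_le_ker_of_notMem (linearIndepOn_iff_notMem_span.1 hli g hg)
  have hzero : ∀ y ∈ s, y ≠ g → f y = 0 := fun y hy hne =>
    hf (Submodule.subset_span ⟨y, ⟨hy, hne⟩, rfl⟩)
  have hnn : ∀ y ∈ s, 0 ≤ (f g • f) y := by
    intro y hy
    rcases eq_or_ne y g with rfl | hne
    · exact mul_self_nonneg (f y)
    · simp [hzero y hy hne]
  refine ⟨f g • f, hnn, ?_⟩
  rw [zeroFace_hull hnn]
  congr 1
  ext y
  refine and_congr_right fun hy => ?_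
  rw [Set.mem_singleton_iff]
  rcases eq_or_ne y g with rfl | hne
  · simpa using hfg
  · simp [hzero y hy hne, hne]

end ZeroFace

section LinearAlgebra

variable {K E : Type*} [Field K] [AddCommGroup E] [Module K E]

theorem exists_smul_eq_of_ker_le_ker {σ τ : Dual K E}
    (h : LinearMap.ker σ ≤ LinearMap.ker τ) : ∃ r : K, r • σ = τ := by
  have hmem : τ ∈ Submodule.span K (Set.range fun _ : Unit => σ) :=
    mem_span_of_iInf_ker_le_ker (by simpa using h)
  simpa [Submodule.mem_span_singleton] using hmem

theorem exists_basis_option_of_span_eq_ker {ι : Type*} {b : ι → E} (hb : LinearIndependent K b)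
    {ρ : Dual K E} (hspan : Submodule.span K (Set.range b) = LinearMap.ker ρ) {e : E}
    (he : ρ e = 1) :
    ∃ B : Basis (Option ι) K E, (∀ i, B (some i) = b i) ∧ B none = e ∧ B.coord none = ρ := by
  have hbρ (i : ι) : ρ (b i) = 0 := by
    rw [← LinearMap.mem_ker, ← hspan]
    exact Submodule.subset_span ⟨i, rfl⟩
  have hli : LinearIndependent K fun o => Option.casesOn' o e b := by
    refine linearIndependent_option'.2 ⟨hb, fun hmem => ?_⟩
    rw [hspan, LinearMap.mem_ker, he] at hmem
    exact one_ne_zero hmem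
  have htop : ⊤ ≤ Submodule.span K (Set.range fun o => Option.casesOn' o e b) := by
    intro y _
    have hy : y - ρ y • e ∈ Submodule.span K (Set.range b) := by simp [hspan, he]
    rw [← sub_add_cancel y (ρ y • e)]
    refine add_mem (Submodule.span_mono ?_ hy) (Submodule.smul_mem _ _ ?_)
    · rintro _ ⟨i, rfl⟩
      exact ⟨some i, rfl⟩
    · exact Submodule.subset_span ⟨none, rfl⟩
  refine ⟨Basis.mk hli htop, fun i => by simp, by simp, ?_⟩
  refine (Basis.mk hli htop).ext fun o => ?_
  rw [Basis.coord_apply, Basis.repr_self, Basis.mk_apply]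
  cases o <;> simp [he, hbρ]

theorem ker_coord_add_smul_coord_none_le {ι : Type*} (B : Basis (Option ι) K E) {i : ι} {r : K}
    {W : Submodule K E} (hW : ∀ j ≠ i, B (some j) ∈ W) {u : E} (huW : u ∈ W)
    (hu : B.coord none u ≠ 0) (hσu : (B.coord (some i) + r • B.coord none) u = 0) :
    LinearMap.ker (B.coord (some i) + r • B.coord none) ≤ W := by
  intro y hy
  obtain ⟨c, hc⟩ : ∃ c, c * B.coord none u = B.coord none y := ⟨_, div_mul_cancel₀ _ hu⟩
  have hnone : B.coord none (y - c • u) = 0 := by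
    rw [map_sub, map_smul, smul_eq_mul, hc, sub_self]
  have hsome : B.coord (some i) (y - c • u) = 0 := by
    have hσ : (B.coord (some i) + r • B.coord none) (y - c • u) = 0 := by
      rw [map_sub, map_smul, hσu, LinearMap.mem_ker.1 hy, smul_zero, sub_zero]
    rwa [LinearMap.add_apply, LinearMap.smul_apply, hnone, smul_zero, add_zero] at hσ
  have hridge : Submodule.span K (B '' {o | B.coord o (y - c • u) ≠ 0}) ≤ W := by
    refine Submodule.span_le.2 ?_
    rintro _ ⟨_ | j, hj, rfl⟩
    · exact absurd hnone hj
    · exact hW j fun h => hj (h ▸ hsome)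
  rw [← sub_add_cancel y (c • u)]
  exact add_mem (hridge (B.mem_span_image.2 fun o ho => Finsupp.mem_support_iff.1 ho))
    (W.smul_mem c huW)

end LinearAlgebra

section Facets

variable {n : ℕ} {C : PointedCone ℝ (Fin n → ℝ)}

theorem isFacet_zeroFace_iff {σ : Dual ℝ (Fin n → ℝ)}
    (hC : Submodule.span ℝ (C : Set (Fin n → ℝ)) = ⊤) (hσ : σ ≠ 0) (hnn : ∀ y ∈ C, 0 ≤ σ y) :
    IsFacet (zeroFace C σ) C ↔
      Submodule.span ℝ (zeroFace C σ : Set (Fin n → ℝ)) = LinearMap.ker σ := by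
  have hker := Module.Dual.finrank_ker_add_one_of_ne_zero hσ
  rw [IsFacet, and_iff_right (zeroFace_isFaceOf hnn), coneDim, coneDim, hC, finrank_top]
  refine ⟨fun h => ?_, fun h => by rw [h, hker]⟩
  exact Submodule.eq_of_le_of_finrank_eq (span_zeroFace_le_ker C σ) (by lia)

theorem coneDim_hull_of_linearIndepOn {s : Set (Fin n → ℝ)} (hli : LinearIndepOn ℝ id s) :
    coneDim (hull ℝ s) = s.ncard := by
  have := hli.linearIndependent.setFinite.fintype
  rw [coneDim, span_hull, finrank_span_set_eq_card hli, Set.ncard_eq_toFinset_card']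

theorem isFacet_hull_sdiff_singleton {s : Set (Fin n → ℝ)} (hli : LinearIndepOn ℝ id s)
    {g : Fin n → ℝ} (hg : g ∈ s) : IsFacet (hull ℝ (s \ {g})) (hull ℝ s) := by
  obtain ⟨τ, hnn, hτ⟩ := exists_zeroFace_hull_eq_hull_sdiff_singleton hli hg
  refine ⟨hτ ▸ zeroFace_isFaceOf (nonneg_of_mem_hull hnn), ?_⟩
  rw [coneDim_hull_of_linearIndepOn hli, coneDim_hull_of_linearIndepOn (hli.mono Set.sdiff_subset)]
  exact Set.ncard_sdiff_singleton_add_one hg hli.linearIndependent.setFinite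

/-- Rotate the supporting hyperplane `B.coord none = 0` about the ridge on which moreover the
coordinate `i` vanishes, until it meets a further generator. -/
theorem exists_adjacent_facet {ι : Type*} (B : Basis (Option ι) ℝ (Fin n → ℝ))
    {t : Set (Fin n → ℝ)} (ht : t.Finite) (htop : Submodule.span ℝ t = ⊤)
    (hρ : ∀ y ∈ t, 0 ≤ B.coord none y)
    (hface : zeroFace (hull ℝ t) (B.coord none) = hull ℝ (Set.range fun i => B (some i))) (i : ι) :
    ∃ r : ℝ, (∀ y ∈ hull ℝ t, 0 ≤ (B.coord (some i) + r • B.coord none) y) ∧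
      IsFacet (zeroFace (hull ℝ t) (B.coord (some i) + r • B.coord none)) (hull ℝ t) := by
  have hne (o : Option ι) : B.coord o ≠ 0 := fun h => by simpa using LinearMap.congr_fun h (B o)
  have hτ : ∀ y ∈ hull ℝ (Set.range fun j => B (some j)), 0 ≤ B.coord (some i) y := by
    refine nonneg_of_mem_hull ?_
    rintro _ ⟨j, rfl⟩
    rw [Basis.coord_apply, Basis.repr_self]
    exact Finsupp.single_nonneg.2 zero_le_one _
  obtain ⟨r, hnn, u, hut, hρu, hσu⟩ := exists_tight_add_smul ht hρ
    (exists_pos_of_span_eq_top htop (hne none) hρ)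
    fun u hu h0 => hτ u (hface ▸ mem_zeroFace.2 ⟨subset_hull hu, h0⟩)
  refine ⟨r, nonneg_of_mem_hull hnn, ?_⟩
  have hσ : B.coord (some i) + r • B.coord none ≠ 0 := fun h => by
    simpa using LinearMap.congr_fun h (B (some i))
  rw [isFacet_zeroFace_iff (by rwa [span_hull]) hσ (nonneg_of_mem_hull hnn)]
  refine le_antisymm (span_zeroFace_le_ker _ _) (ker_coord_add_smul_coord_none_le B
    (fun j hj => Submodule.subset_span ?_) (Submodule.subset_span ⟨subset_hull hut, hσu⟩)
    hρu.ne' hσu)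
  have hmem : B (some j) ∈ zeroFace (hull ℝ t) (B.coord none) := hface ▸ subset_hull ⟨j, rfl⟩
  exact ⟨hmem.1, by simp [hj]⟩

end Facets

section Rationality

theorem exists_gcd_eq_one_forall_sum_mul_eq_zero {ι M : Type*} [Fintype ι] [AddCommGroup M]
    [IsTorsionFree ℤ M] {a : ι → M} (ha : a ≠ 0) :
    ∃ c : ι → ℤ, Finset.univ.gcd c = 1 ∧
      ∀ u : ι → ℤ, ∑ i, u i • a i = 0 → ∑ i, u i * c i = 0 := by
  obtain ⟨i₀, hi₀⟩ := Function.ne_iff.1 ha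
  let A : Submodule ℤ M := Submodule.span ℤ (Set.range a)
  let a' (i : ι) : A := ⟨a i, Submodule.subset_span ⟨i, rfl⟩⟩
  have : Module.Finite ℤ A := Module.Finite.span_of_finite ℤ (Set.finite_range a)
  obtain ⟨f, hf⟩ : ∃ f : Dual ℤ A, f (a' i₀) ≠ 0 := by
    by_contra! h
    exact hi₀ (congrArg Subtype.val ((forall_dual_apply_eq_zero_iff ℤ (a' i₀)).1 h))
  obtain ⟨c, hc, hgcd⟩ := Finset.univ.extract_gcd (fun i => f (a' i)) ⟨i₀, Finset.mem_univ i₀⟩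
  set g := Finset.univ.gcd fun i => f (a' i)
  have hg : g ≠ 0 := fun h => hf (by rw [hc i₀ (Finset.mem_univ i₀), h, zero_mul])
  refine ⟨c, hgcd, fun u hu => (mul_eq_zero.1 ?_).resolve_left hg⟩
  have hu' : ∑ i, u i • a' i = 0 := Subtype.ext (by simpa [a'] using hu)
  calc g * ∑ i, u i * c i = ∑ i, u i * f (a' i) := by
        rw [Finset.mul_sum]
        exact Finset.sum_congr rfl fun i hi => by rw [hc i hi, mul_left_comm]
    _ = f (∑ i, u i • a' i) := by simp only [map_sum, map_smul, smul_eq_mul]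
    _ = 0 := by rw [hu', map_zero]

variable {n : ℕ}

/-- A rational polyhedral cone: one generated by finitely many integral vectors. -/
def IsRational (C : PointedCone ℝ (Fin n → ℝ)) : Prop :=
  ∃ S : Set (Fin n → ℤ), S.Finite ∧ hull ℝ ((fun u j => (u j : ℝ)) '' S) = C

theorem IsRational.finite_setOf_isFaceOf {C : PointedCone ℝ (Fin n → ℝ)} (hC : IsRational C) :
    {G : PointedCone ℝ (Fin n → ℝ) | G.IsFaceOf C}.Finite := by
  obtain ⟨S, hS, rfl⟩ := hC
  exact finite_setOf_isFaceOf_hull (hS.image _)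

theorem dual_apply_eq_sum {ι R : Type*} [Fintype ι] [DecidableEq ι] [CommSemiring R]
    (σ : Dual R (ι → R)) (y : ι → R) :
    σ y = ∑ j, y j * σ (Pi.single j 1) := by
  conv_lhs => rw [← (Pi.basisFun R ι).sum_repr y]
  simp

theorem exists_isPrimitive_forall_eq_zero {σ : Dual ℝ (Fin n → ℝ)} (hσ : σ ≠ 0) :
    ∃ κ : Dual ℝ (Fin n → ℝ), IsPrimitive κ ∧
      ∀ u : Fin n → ℤ, σ (fun j => (u j : ℝ)) = 0 → κ (fun j => (u j : ℝ)) = 0 := by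
  have ha : (fun j => σ (Pi.single j 1)) ≠ 0 := fun h =>
    hσ (LinearMap.pi_ext' fun j => LinearMap.ext_ring (congrFun h j))
  obtain ⟨c, hgcd, hc⟩ := exists_gcd_eq_one_forall_sum_mul_eq_zero ha
  refine ⟨Fintype.linearCombination ℝ fun j => (c j : ℝ), ⟨c, by simp, hgcd⟩, fun u hu => ?_⟩
  have hcu := hc u (by simpa using (dual_apply_eq_sum σ _).symm.trans hu)
  simpa [Fintype.linearCombination_apply] using congrArg (Int.cast : ℤ → ℝ) hcu

theorem IsPrimitive.neg {σ : Dual ℝ (Fin n → ℝ)} (h : IsPrimitive σ) : IsPrimitive (-σ) := by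
  obtain ⟨a, ha, hgcd⟩ := h
  refine ⟨fun i => -1 * a i, fun i => by simp [ha], ?_⟩
  rw [Finset.gcd_mul_left, hgcd]
  rfl

theorem IsPrimitive.ne_zero {σ : Dual ℝ (Fin n → ℝ)} (h : IsPrimitive σ) : σ ≠ 0 := by
  rintro rfl
  obtain ⟨a, ha, hgcd⟩ := h
  have ha0 : ∀ i ∈ Finset.univ, a i = 0 := fun i _ => Int.cast_eq_zero.1 (ha i).symm
  rw [Finset.gcd_eq_zero_iff.2 ha0] at hgcd
  exact zero_ne_one hgcd

theorem exists_pos_isPrimitive_smul {C : PointedCone ℝ (Fin n → ℝ)} (hC : IsRational C)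
    {σ : Dual ℝ (Fin n → ℝ)} (hσ : σ ≠ 0) (hnn : ∀ y ∈ C, 0 ≤ σ y)
    (hspan : Submodule.span ℝ (zeroFace C σ : Set (Fin n → ℝ)) = LinearMap.ker σ) :
    ∃ r : ℝ, 0 < r ∧ IsPrimitive (r • σ) := by
  obtain ⟨S, -, rfl⟩ := hC
  obtain ⟨κ, hκ, hker⟩ := exists_isPrimitive_forall_eq_zero hσ
  have hle : LinearMap.ker σ ≤ LinearMap.ker κ := by
    rw [← hspan, zeroFace_hull fun y hy => hnn y (subset_hull hy), span_hull, Submodule.span_le]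
    rintro _ ⟨⟨u, -, rfl⟩, hu⟩
    exact hker u hu
  obtain ⟨r, rfl⟩ := exists_smul_eq_of_ker_le_ker hle
  rcases lt_trichotomy r 0 with hr | rfl | hr
  · exact ⟨-r, neg_pos.2 hr, (neg_smul r σ).symm ▸ hκ.neg⟩
  · exact absurd (zero_smul ℝ σ) hκ.ne_zero
  · exact ⟨r, hr, hκ⟩

theorem IsSupportForm.zeroFace_eq {C F : PointedCone ℝ (Fin n → ℝ)} {κ : Dual ℝ (Fin n → ℝ)}
    (h : IsSupportForm C F κ) (hF : F ≤ C) : zeroFace C κ = F := by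
  ext y
  exact ⟨fun hy => (h.mem_iff y hy.1).2 hy.2, fun hy => ⟨hF hy, (h.mem_iff y (hF hy)).1 hy⟩⟩

theorem isSupportForm_supportForm {C F : PointedCone ℝ (Fin n → ℝ)}
    (h : ∃ κ, IsSupportForm C F κ) : IsSupportForm C F (supportForm C F) := by
  rw [supportForm, dif_pos h]
  exact h.choose_spec

theorem exists_pos_supportForm_zeroFace_eq_smul {C : PointedCone ℝ (Fin n → ℝ)}
    (hC : IsRational C) (htop : Submodule.span ℝ (C : Set (Fin n → ℝ)) = ⊤)
    {σ : Dual ℝ (Fin n → ℝ)} (hσ : σ ≠ 0) (hnn : ∀ y ∈ C, 0 ≤ σ y)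
    (hfacet : IsFacet (zeroFace C σ) C) :
    ∃ r : ℝ, 0 < r ∧ supportForm C (zeroFace C σ) = r • σ := by
  have hspan := (isFacet_zeroFace_iff htop hσ hnn).1 hfacet
  obtain ⟨r, hr, hprim⟩ := exists_pos_isPrimitive_smul hC hσ hnn hspan
  have hκ : IsSupportForm C (zeroFace C σ) (supportForm C (zeroFace C σ)) := by
    refine isSupportForm_supportForm
      ⟨r • σ, hprim, fun y hy => mul_nonneg hr.le (hnn y hy), fun y hy => ?_⟩
    rw [← zeroFace_smul C σ hr.ne', mem_zeroFace, and_iff_right hy]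
  have hker : LinearMap.ker σ ≤ LinearMap.ker (supportForm C (zeroFace C σ)) := by
    conv_lhs => rw [← hspan, ← hκ.zeroFace_eq inf_le_left]
    exact span_zeroFace_le_ker C _
  obtain ⟨q, hq⟩ := exists_smul_eq_of_ker_le_ker hker
  obtain ⟨y, hy, hpos⟩ := exists_pos_of_span_eq_top htop hκ.primitive.ne_zero hκ.nonneg
  rw [← hq, LinearMap.smul_apply, smul_eq_mul] at hpos
  exact ⟨q, pos_of_mul_pos_left hpos (hnn y hy), hq.symm⟩

end Rationality

section Bottom

variable {d : ℕ} {C F G : PointedCone ℝ (Fin (d + 1) → ℝ)}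

theorem isSupportForm_of_mem_bottomFacets (hF : F ∈ bottomFacets C) :
    IsSupportForm C F (supportForm C F) := by
  refine isSupportForm_supportForm ?_
  by_contra h
  exact hF.2.ne' (by rw [supportForm, dif_neg h, LinearMap.zero_apply])

theorem normForm_eq_inv_smul (C F : PointedCone ℝ (Fin (d + 1) → ℝ)) : normForm C F =
    (supportForm C F (Pi.single (Fin.last d) 1))⁻¹ • supportForm C F := by
  rw [normForm, down, Pi.single_neg, map_neg, inv_neg, neg_neg]

theorem normForm_nonneg (hF : F ∈ bottomFacets C) : ∀ y ∈ C, 0 ≤ normForm C F y := by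
  intro y hy
  rw [normForm_eq_inv_smul]
  exact mul_nonneg (inv_nonneg.2 hF.2.le) ((isSupportForm_of_mem_bottomFacets hF).nonneg y hy)

theorem normForm_apply_single_last (hF : F ∈ bottomFacets C) :
    normForm C F (Pi.single (Fin.last d) 1) = 1 := by
  rw [normForm_eq_inv_smul]
  exact inv_mul_cancel₀ hF.2.ne'

theorem normForm_ne_zero (hF : F ∈ bottomFacets C) : normForm C F ≠ 0 := fun h => by
  simpa [h] using normForm_apply_single_last hF

theorem zeroFace_normForm (hF : F ∈ bottomFacets C) : zeroFace C (normForm C F) = F := by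
  rw [normForm_eq_inv_smul, zeroFace_smul _ _ (inv_ne_zero hF.2.ne'),
    (isSupportForm_of_mem_bottomFacets hF).zeroFace_eq hF.1.1.le]

theorem normForm_injOn : Set.InjOn (normForm C) (bottomFacets C) := fun F hF G hG h => by
  rw [← zeroFace_normForm hF, h, zeroFace_normForm hG]

theorem zeroFace_mem_bottomFacets (hC : IsRational C)
    (htop : Submodule.span ℝ (C : Set (Fin (d + 1) → ℝ)) = ⊤) {σ : Dual ℝ (Fin (d + 1) → ℝ)}
    (hnn : ∀ y ∈ C, 0 ≤ σ y) (hfacet : IsFacet (zeroFace C σ) C)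
    (hlast : 0 < σ (Pi.single (Fin.last d) 1)) :
    zeroFace C σ ∈ bottomFacets C ∧
      normForm C (zeroFace C σ) = (σ (Pi.single (Fin.last d) 1))⁻¹ • σ := by
  have hσ : σ ≠ 0 := fun h => by simp [h] at hlast
  obtain ⟨r, hr, hκ⟩ := exists_pos_supportForm_zeroFace_eq_smul hC htop hσ hnn hfacet
  refine ⟨⟨hfacet, hκ ▸ mul_pos hr hlast⟩, ?_⟩
  rw [normForm_eq_inv_smul, hκ, LinearMap.smul_apply, smul_smul, smul_eq_mul, mul_inv,
    mul_right_comm, inv_mul_cancel₀ hr.ne', one_mul]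

theorem span_of_mem_bottomFacets (htop : Submodule.span ℝ (C : Set (Fin (d + 1) → ℝ)) = ⊤)
    (hF : F ∈ bottomFacets C) :
    Submodule.span ℝ (F : Set (Fin (d + 1) → ℝ)) = LinearMap.ker (normForm C F) := by
  have h := isFacet_zeroFace_iff htop (normForm_ne_zero hF) (normForm_nonneg hF)
  rw [zeroFace_normForm hF] at h
  exact h.1 hF.1

theorem coneDim_of_mem_bottomFacets (htop : Submodule.span ℝ (C : Set (Fin (d + 1) → ℝ)) = ⊤)
    (hF : F ∈ bottomFacets C) : coneDim F = d := by
  have h := hF.1.2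
  rw [coneDim, coneDim, htop, finrank_top, finrank_fin_fun] at h
  exact Nat.succ_injective h

theorem eq_of_le_of_mem_bottomFacets
    (htop : Submodule.span ℝ (C : Set (Fin (d + 1) → ℝ)) = ⊤) (hF : F ∈ bottomFacets C)
    (hG : G ∈ bottomFacets C) (h : F ≤ G) : F = G := by
  have hspan : Submodule.span ℝ (F : Set (Fin (d + 1) → ℝ)) = Submodule.span ℝ G :=
    Submodule.eq_of_le_of_finrank_eq (Submodule.span_mono h)
      ((coneDim_of_mem_bottomFacets htop hF).trans (coneDim_of_mem_bottomFacets htop hG).symm)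
  refine le_antisymm h fun y hy => ?_
  rw [← zeroFace_normForm hF]
  refine ⟨hG.1.1.le hy, ?_⟩
  change y ∈ LinearMap.ker (normForm C F)
  rw [← span_of_mem_bottomFacets htop hF, hspan]
  exact Submodule.subset_span hy

theorem mem_bottom_of_mem_bottomFacets (hF : F ∈ bottomFacets C) : F ∈ bottom C :=
  ⟨F, hF, .rfl⟩

theorem isFaceOf_of_mem_bottom (hF : F ∈ bottom C) : F.IsFaceOf C := by
  obtain ⟨G, hG, hFG⟩ := hF
  exact hFG.trans hG.1.1

theorem setOf_maximal_mem_bottom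
    (htop : Submodule.span ℝ (C : Set (Fin (d + 1) → ℝ)) = ⊤) :
    {M | Maximal (· ∈ bottom C) M} = bottomFacets C := by
  ext M
  constructor
  · rintro ⟨⟨F, hF, hMF⟩, hmax⟩
    rwa [le_antisymm hMF.le (hmax (mem_bottom_of_mem_bottomFacets hF) hMF.le)]
  · refine fun hM => ⟨mem_bottom_of_mem_bottomFacets hM, ?_⟩
    rintro G ⟨F, hF, hGF⟩ hMG
    exact eq_of_le_of_mem_bottomFacets htop hM hF (hMG.trans hGF.le) ▸ hGF.le

theorem isSimplicialComplex_bottom (hC : IsRational C)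
    (hsimp : ∀ F ∈ bottomFacets C, F.IsSimplicial) : IsSimplicialComplex (bottom C) where
  finite := hC.finite_setOf_isFaceOf.subset fun _ => isFaceOf_of_mem_bottom
  simplicial := by
    rintro D ⟨F, hF, hDF⟩
    exact isSimplicial_of_isFaceOf hDF (hsimp F hF)
  face_mem := by
    rintro D ⟨F, hF, hDF⟩ G hGD
    exact ⟨F, hF, hGD.trans hDF⟩
  inter_face D hD D' hD' := by
    have h := isFaceOf_of_mem_bottom hD
    have h' := isFaceOf_of_mem_bottom hD'
    exact ⟨((h.inf_left h').isFaceOf_iff_le h).2 inf_le_left,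
      ((h.inf_left h').isFaceOf_iff_le h').2 inf_le_right⟩

end Bottom

section Exchange

theorem exists_pos_coord_neg {ι K E V : Type*} [Finite ι] [Field K] [LinearOrder K]
    [AddCommGroup E] [Module K E] [AddCommGroup V] [LinearOrder V] [IsOrderedAddMonoid V]
    [Module K V] [PosSMulMono K V] (B : Basis (Option ι) K E) (Φ : Dual K E →ₗ[K] V)
    {φ : Dual K E} (hnone : φ (B none) = 1) (hsome : ∀ i, 0 ≤ φ (B (some i)))
    (hlt : Φ φ < Φ (B.coord none)) : ∃ i, 0 < φ (B (some i)) ∧ Φ (B.coord (some i)) < 0 := by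
  have := Fintype.ofFinite ι
  contrapose! hlt
  have hexp : Φ φ = Φ (B.coord none) + ∑ i, φ (B (some i)) • Φ (B.coord (some i)) := by
    conv_lhs => rw [← B.sum_dual_apply_smul_coord φ, Fintype.sum_option, hnone, one_smul]
    simp only [map_add, map_sum, map_smul]
  rw [hexp, le_add_iff_nonneg_right]
  refine Finset.sum_nonneg fun i _ => ?_
  rcases (hsome i).eq_or_lt with h | h
  · rw [← h, zero_smul]
  · exact smul_nonneg h.le (hlt i h)

variable {d : ℕ} {C F : PointedCone ℝ (Fin (d + 1) → ℝ)}

theorem exists_basis_option_of_mem_bottomFacets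
    (htop : Submodule.span ℝ (C : Set (Fin (d + 1) → ℝ)) = ⊤) (hF : F ∈ bottomFacets C)
    {s : Set (Fin (d + 1) → ℝ)} (hli : LinearIndepOn ℝ id s) (hs : hull ℝ s = F) :
    ∃ B : Basis (Option s) ℝ (Fin (d + 1) → ℝ), (∀ g : s, B (some g) = g) ∧
      B none = Pi.single (Fin.last d) 1 ∧ B.coord none = normForm C F := by
  refine exists_basis_option_of_span_eq_ker hli ?_ (normForm_apply_single_last hF)
  rw [← span_of_mem_bottomFacets htop hF, ← hs, span_hull]
  simp

variable {V : Type*} [AddCommGroup V] [LinearOrder V] [IsOrderedAddMonoid V] [Module ℝ V]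
  [PosSMulStrictMono ℝ V] {Φ : Dual ℝ (Fin (d + 1) → ℝ) →ₗ[ℝ] V}

/-- Positivity of `Φ` on the adjacent form `τ_i + r ρ_F` forces `0 < r`, so that the adjacent facet
belongs to the bottom, with normalized form `ρ_F + r⁻¹ τ_i`. -/
theorem exists_adjacent_bottomFacet_lt (hC : IsRational C)
    (htop : Submodule.span ℝ (C : Set (Fin (d + 1) → ℝ)) = ⊤)
    (hΦ : ∀ σ : Dual ℝ (Fin (d + 1) → ℝ), σ ≠ 0 → (∀ y ∈ C, 0 ≤ σ y) → 0 < Φ σ)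
    (hF : F ∈ bottomFacets C) {ι : Type*} (B : Basis (Option ι) ℝ (Fin (d + 1) → ℝ))
    (hhull : hull ℝ (Set.range fun i => B (some i)) = F)
    (hnone : B none = Pi.single (Fin.last d) 1) (hcoord : B.coord none = normForm C F) {i : ι}
    (hi : Φ (B.coord (some i)) < 0) :
    ∃ F' ∈ bottomFacets C, Φ (normForm C F') < Φ (normForm C F) ∧ ∀ j ≠ i, B (some j) ∈ F' := by
  obtain ⟨r, hnn, hfacet⟩ : ∃ r : ℝ,
      (∀ y ∈ C, 0 ≤ (B.coord (some i) + r • B.coord none) y) ∧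
      IsFacet (zeroFace C (B.coord (some i) + r • B.coord none)) C := by
    obtain ⟨S, hS, rfl⟩ := hC
    refine exists_adjacent_facet B (hS.image _) (by rwa [span_hull] at htop) ?_ ?_ i
    · exact fun y hy => hcoord ▸ normForm_nonneg hF y (subset_hull hy)
    · rw [hcoord, zeroFace_normForm hF, hhull]
  set σ := B.coord (some i) + r • B.coord none with hσ
  have hσ0 : σ ≠ 0 := fun h => by simpa [hσ] using LinearMap.congr_fun h (B (some i))
  have hΦσ : 0 < Φ (B.coord (some i)) + r • Φ (B.coord none) := by
    simpa [hσ] using hΦ σ hσ0 hnn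
  have hr : 0 < r := by
    have hΦρ : 0 < Φ (B.coord none) := hcoord ▸ hΦ _ (normForm_ne_zero hF) (normForm_nonneg hF)
    exact pos_of_smul_pos_right ((neg_pos.2 hi).trans (neg_lt_iff_pos_add'.2 hΦσ)) hΦρ.le
  have hσe : σ (Pi.single (Fin.last d) 1) = r := by simp [hσ, ← hnone]
  obtain ⟨hbot, hnorm⟩ := zeroFace_mem_bottomFacets hC htop hnn hfacet (hσe.symm ▸ hr)
  refine ⟨_, hbot, ?_, fun j hj => ?_⟩
  · rw [hnorm, hσe, ← hcoord, hσ, smul_add, inv_smul_smul₀ hr.ne', map_add, map_smul]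
    exact add_lt_of_neg_left _ (smul_neg_of_pos_of_neg (inv_pos.2 hr) hi)
  · have hjF : B (some j) ∈ F := hhull ▸ subset_hull ⟨j, rfl⟩
    exact ⟨hF.1.1.le hjF, by simp [hσ, hj]⟩

theorem exists_facet_le_bottomFacet_lt (hC : IsRational C)
    (htop : Submodule.span ℝ (C : Set (Fin (d + 1) → ℝ)) = ⊤)
    (hΦ : ∀ σ : Dual ℝ (Fin (d + 1) → ℝ), σ ≠ 0 → (∀ y ∈ C, 0 ≤ σ y) → 0 < Φ σ)
    (hF : F ∈ bottomFacets C) (hsimp : F.IsSimplicial) {F' : PointedCone ℝ (Fin (d + 1) → ℝ)}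
    (hF' : F' ∈ bottomFacets C) (hlt : Φ (normForm C F') < Φ (normForm C F)) :
    ∃ G, IsFacet G F ∧ F ⊓ F' ≤ G ∧
      ∃ F'' ∈ bottomFacets C, Φ (normForm C F'') < Φ (normForm C F) ∧ G ≤ F'' := by
  obtain ⟨s, hs, hli, hhull⟩ := hsimp
  have := hs.to_subtype
  obtain ⟨B, hsome, hnone, hcoord⟩ := exists_basis_option_of_mem_bottomFacets htop hF hli hhull
  have hsC : ∀ g : s, (g : Fin (d + 1) → ℝ) ∈ C := fun g =>
    hF.1.1.le (hhull ▸ subset_hull g.2)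
  obtain ⟨g, hg, hΦg⟩ := exists_pos_coord_neg B Φ
    (by rw [hnone, normForm_apply_single_last hF'])
    (fun g => by rw [hsome]; exact normForm_nonneg hF' _ (hsC g)) (by rwa [hcoord])
  obtain ⟨F'', hF'', hlt', hmem⟩ := exists_adjacent_bottomFacet_lt hC htop hΦ hF B
    (by simpa [hsome] using hhull) hnone hcoord hΦg
  refine ⟨hull ℝ (s \ {↑g}), hhull ▸ isFacet_hull_sdiff_singleton hli g.2, ?_, F'', hF'', hlt', ?_⟩
  · have hface : (F ⊓ F').IsFaceOf (hull ℝ s) := hhull ▸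
      ((hF.1.1.inf_left hF'.1.1).isFaceOf_iff_le hF.1.1).2 inf_le_left
    rw [← hull_inter_eq_of_isFaceOf_hull hface]
    refine Submodule.span_mono fun y hy => ⟨hy.1, ?_⟩
    rintro rfl
    have hzero : (g : Fin (d + 1) → ℝ) ∈ zeroFace C (normForm C F') :=
      (zeroFace_normForm hF').symm ▸ hy.2.2
    exact hg.ne' (hsome g ▸ hzero.2)
  · refine Submodule.span_le.2 fun y hy => ?_
    simpa [hsome] using hmem ⟨y, hy.1⟩ fun h => hy.2 (congrArg Subtype.val h)

end Exchange

section Shelling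

theorem exists_facets_inter_iUnion_eq {n : ℕ} {ι : Type*} [LT ι]
    {D : ι → PointedCone ℝ (Fin n → ℝ)} {i : ι}
    (h : ∀ j < i, ∃ G, IsFacet G (D i) ∧ D i ⊓ D j ≤ G ∧ ∃ l < i, G ≤ D l) :
    ∃ S : Set (PointedCone ℝ (Fin n → ℝ)), (∀ G ∈ S, IsFacet G (D i)) ∧
      (D i : Set (Fin n → ℝ)) ∩ (⋃ j, ⋃ (_ : j < i), (D j : Set (Fin n → ℝ))) =
        ⋃ G ∈ S, (G : Set (Fin n → ℝ)) := by
  refine ⟨{G | IsFacet G (D i) ∧ ∃ l < i, G ≤ D l}, fun G hG => hG.1, Set.Subset.antisymm ?_ ?_⟩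
  · rintro y ⟨hyi, hy⟩
    obtain ⟨j, hj, hyj⟩ := Set.mem_iUnion₂.1 hy
    obtain ⟨G, hG, hle, hl⟩ := h j hj
    exact Set.mem_iUnion₂.2 ⟨G, ⟨hG, hl⟩, hle ⟨hyi, hyj⟩⟩
  · refine Set.iUnion₂_subset fun G ⟨hG, l, hl, hle⟩ y hy => ⟨hG.1.le hy, ?_⟩
    exact Set.mem_iUnion₂.2 ⟨l, hl, hle hy⟩

theorem isShelling_bottom {d : ℕ} {C : PointedCone ℝ (Fin (d + 1) → ℝ)} (hC : IsRational C)
    (htop : Submodule.span ℝ (C : Set (Fin (d + 1) → ℝ)) = ⊤)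
    (hsimp : ∀ F ∈ bottomFacets C, F.IsSimplicial) {V : Type*} [AddCommGroup V] [LinearOrder V]
    [IsOrderedAddMonoid V] [Module ℝ V] [PosSMulStrictMono ℝ V]
    {Φ : Dual ℝ (Fin (d + 1) → ℝ) →ₗ[ℝ] V}
    (hΦ : ∀ σ : Dual ℝ (Fin (d + 1) → ℝ), σ ≠ 0 → (∀ y ∈ C, 0 ≤ σ y) → 0 < Φ σ)
    {k : ℕ} {F : Fin k → PointedCone ℝ (Fin (d + 1) → ℝ)} (hrange : Set.range F = bottomFacets C)
    (hmono : StrictMono fun i => Φ (normForm C (F i))) : IsShelling (bottom C) d F where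
  isComplex := isSimplicialComplex_bottom hC hsimp
  pure M hM := by
    have hM' : M ∈ bottomFacets C := setOf_maximal_mem_bottom htop ▸ hM
    exact coneDim_of_mem_bottomFacets htop hM'
  injective := hmono.injective.of_comp (f := fun G => Φ (normForm C G))
  range_eq := hrange.trans (setOf_maximal_mem_bottom htop).symm
  inter_eq i := by
    have hF (j : Fin k) : F j ∈ bottomFacets C := hrange ▸ Set.mem_range_self j
    refine exists_facets_inter_iUnion_eq fun j hj => ?_
    obtain ⟨G, hG, hle, F'', hF'', hlt, hGF⟩ :=
      exists_facet_le_bottomFacet_lt hC htop hΦ (hF i) (hsimp _ (hF i)) (hF j) (hmono hj)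
    obtain ⟨l, rfl⟩ := hrange.symm ▸ hF''
    exact ⟨G, hG, hle, l, hmono.lt_iff_lt.1 hlt, hGF⟩

end Shelling

section LexicographicOrder

instance posSMulStrictMono_lex_pi {ι K : Type*} {M : ι → Type*} [LinearOrder ι] [Zero K]
    [Preorder K] [∀ i, PartialOrder (M i)] [∀ i, SMul K (M i)] [∀ i, PosSMulStrictMono K (M i)] :
    PosSMulStrictMono K (Lex (∀ i, M i)) where
  smul_lt_smul_of_pos_left c hc a b hab := by
    obtain ⟨i, heq, hlt⟩ := hab
    exact ⟨i, fun j hj => congrArg (c • ·) (heq j hj), smul_lt_smul_of_pos_left hlt hc⟩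

instance posSMulStrictMono_lex_prod {K α β : Type*} [Zero K] [Preorder K] [Preorder α]
    [Preorder β] [SMul K α] [SMul K β] [PosSMulStrictMono K α] [PosSMulStrictMono K β] :
    PosSMulStrictMono K (α ×ₗ β) where
  smul_lt_smul_of_pos_left c hc a b hab := by
    rw [Prod.Lex.lt_iff] at hab ⊢
    rcases hab with hlt | ⟨heq, hlt⟩
    · exact Or.inl (smul_lt_smul_of_pos_left hlt hc)
    · exact Or.inr ⟨congrArg (c • ·) heq, smul_lt_smul_of_pos_left hlt hc⟩

/-- The value of a linear form at `x`, followed by its coefficients, in lexicographic order: the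
order `Precedes` is the pullback of this order along `normForm`. -/
def evalLex {n : ℕ} (x : Fin n → ℝ) : Dual ℝ (Fin n → ℝ) →ₗ[ℝ] ℝ ×ₗ Lex (Fin n → ℝ) where
  toFun σ := toLex (σ x, lexCoeff σ)
  map_add' _ _ := rfl
  map_smul' _ _ := rfl

theorem evalLex_injective {n : ℕ} (x : Fin n → ℝ) : Function.Injective (evalLex x) := by
  intro σ τ h
  have hcoeff : lexCoeff σ = lexCoeff τ := congrArg (fun p => (ofLex p).2) h
  exact LinearMap.pi_ext' fun i => LinearMap.ext_ring (congrFun hcoeff i)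

theorem pos_of_mem_interior {E : Type*} [AddCommGroup E] [Module ℝ E] [TopologicalSpace E]
    [IsTopologicalAddGroup E] [ContinuousSMul ℝ E] [FiniteDimensional ℝ E] [T2Space E]
    {C : Set E} {x : E} (hx : x ∈ interior C) {σ : Dual ℝ E} (hσ : σ ≠ 0)
    (hnn : ∀ y ∈ C, 0 ≤ σ y) : 0 < σ x := by
  have hopen : IsOpenMap σ :=
    LinearMap.isOpenMap_of_finiteDimensional σ (LinearMap.surjective hσ)
  have hmem : σ x ∈ interior (Set.Ici (0 : ℝ)) :=
    interior_mono (Set.image_subset_iff.2 hnn) (hopen.image_interior_subset C ⟨x, hx, rfl⟩)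
  rwa [interior_Ici] at hmem

variable {d : ℕ} {C : PointedCone ℝ (Fin (d + 1) → ℝ)} {x : Fin (d + 1) → ℝ}

theorem evalLex_pos (hx : x ∈ interior (C : Set (Fin (d + 1) → ℝ)))
    (σ : Dual ℝ (Fin (d + 1) → ℝ)) (hσ : σ ≠ 0) (hnn : ∀ y ∈ C, 0 ≤ σ y) : 0 < evalLex x σ :=
  Prod.Lex.toLex_lt_toLex.2 (Or.inl (pos_of_mem_interior hx hσ hnn))

theorem precedes_iff_evalLex_lt {F G : PointedCone ℝ (Fin (d + 1) → ℝ)} :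
    Precedes C x F G ↔ evalLex x (normForm C F) < evalLex x (normForm C G) := by
  rw [Prod.Lex.lt_iff]
  rfl

theorem isStrictTotalOrder_precedes (C : PointedCone ℝ (Fin (d + 1) → ℝ))
    (x : Fin (d + 1) → ℝ) :
    IsStrictTotalOrder (bottomFacets C) (fun F G => Precedes C x F G) :=
  let f : bottomFacets C ↪ ℝ ×ₗ Lex (Fin (d + 1) → ℝ) :=
    ⟨fun F => evalLex x (normForm C F), (evalLex_injective x).comp normForm_injOn.injective⟩
  RelEmbedding.isStrictTotalOrder (s := (· < ·)) ⟨f, precedes_iff_evalLex_lt.symm⟩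

end LexicographicOrder

theorem isRational_liftedCone {d m : ℕ} (v : Fin m → Fin d → ℤ) (w : Fin m → ℤ) :
    IsRational (liftedCone v w) := by
  refine ⟨Set.range fun i => Fin.snoc (α := fun _ => ℤ) (v i) (w i), Set.finite_range _, ?_⟩
  rw [liftedCone, ← Set.range_comp]
  congr 2
  ext i j
  refine Fin.lastCases ?_ (fun j => ?_) j <;> simp

end LiftedCone

theorem mainTheorem3_general {d : ℕ} {C : PointedCone ℝ (Fin (d + 1) → ℝ)}
    (hC : LiftedCone.IsRational C) (hsimp : ∀ F ∈ LiftedCone.bottomFacets C, F.IsSimplicial)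
    {x : Fin (d + 1) → ℝ} (hx : x ∈ interior (C : Set (Fin (d + 1) → ℝ))) :
    (LiftedCone.bottomFacets C).Finite ∧
    IsStrictTotalOrder (LiftedCone.bottomFacets C) (fun F G => LiftedCone.Precedes C x F G) ∧
    ∀ (k : ℕ) (F : Fin k → PointedCone ℝ (Fin (d + 1) → ℝ)),
      Set.range F = LiftedCone.bottomFacets C →
      (∀ i j, i < j → LiftedCone.Precedes C x (F i) (F j)) →
      LiftedCone.IsShelling (LiftedCone.bottom C) d F := by
  have htop : Submodule.span ℝ (C : Set (Fin (d + 1) → ℝ)) = ⊤ :=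
    Submodule.eq_top_of_nonempty_interior' _ ⟨x, interior_mono Submodule.subset_span hx⟩
  refine ⟨hC.finite_setOf_isFaceOf.subset fun F hF => hF.1.1,
    LiftedCone.isStrictTotalOrder_precedes C x, fun k F hrange hprec => ?_⟩
  exact LiftedCone.isShelling_bottom hC htop hsimp (LiftedCone.evalLex_pos hx) hrange
    fun i j hij => LiftedCone.precedes_iff_evalLex_lt.1 (hprec i j hij)

theorem mainTheorem3 {d m : ℕ} (v : Fin m → Fin d → ℤ) (w : Fin m → ℤ) (hw : ∀ i, 0 < w i)
    (hsimp : ∀ F ∈ LiftedCone.bottomFacets (LiftedCone.liftedCone v w), F.IsSimplicial)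
    (x : Fin (d + 1) → ℝ)
    (hx : x ∈ interior (LiftedCone.liftedCone v w : Set (Fin (d + 1) → ℝ))) :
    (LiftedCone.bottomFacets (LiftedCone.liftedCone v w)).Finite ∧
    IsStrictTotalOrder (LiftedCone.bottomFacets (LiftedCone.liftedCone v w))
      (fun F G => LiftedCone.Precedes (LiftedCone.liftedCone v w) x F G) ∧
    ∀ (k : ℕ) (F : Fin k → PointedCone ℝ (Fin (d + 1) → ℝ)),
      Set.range F = LiftedCone.bottomFacets (LiftedCone.liftedCone v w) →
      (∀ i j, i < j → LiftedCone.Precedes (LiftedCone.liftedCone v w) x (F i) (F j)) →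
      LiftedCone.IsShelling (LiftedCone.bottom (LiftedCone.liftedCone v w)) d F := by
  exact mainTheorem3_general (LiftedCone.isRational_liftedCone v w) hsimp hx
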